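/- Let $d\ge 1$, and let $|\cdot|$ denote the $\ell^\infty$-norm on $\mathbb{Z}^d$. For $\phi\in\ell^2(\mathbb{Z}^d)$ let $$\mathcal{LC}(\phi)=\Big\{l\in\mathbb{Z}^d:\ |\phi(l)|=\max_{x\in\mathbb{Z}^d}|\phi(x)|\Big\}$$ be its set of localization centers. Let $C,c,q>0$ and $\epsilon>0$. Then there is a scale $L''_\epsilon\ge 500$, depending only on $\epsilon,C,c,q,d$, with the following property. Let $H$ be a (possibly unbounded) linear operator on $\ell^2(\mathbb{Z}^d)$ that has an orthonormal basis $\{\psi_s\}_{s\in\mathbb{Z}^d}$ of $\ell^2(\mathbb{Z}^d)$ consisting of eigenfunctions, and suppose that these are semi-uniformly localized: $$|\psi_s(x)|\le C(1+|l|)^q e^{-c|x-l|}\qquad\text{for all } s\in\mathbb{Z}^d,\ l\in\mathcal{LC}(\psi_s),\ x\in\mathbb{Z}^d .$$ Then there is a bijection $f:\mathbb{Z}^d\to\mathbb{Z}^d$ such that the relabelled eigenfunctions $\phi_j:=\psi_{f(j)}$ satisfy: for every $j\in\mathbb{Z}^d$ with $|j|\ge L''_\epsilon$ there is $\iota_j\in\mathcal{LC}(\phi_j)$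 with $|j-\iota_j|\le\epsilon|j|$. -/

import Mathlib

/-- The lattice `ℤ^d`; its norm `‖·‖` is the sup norm. -/
abbrev ZLattice (d : ℕ) : Type := Fin d → ℤ

/-- The Hilbert space `ℓ²(ℤ^d)` of square-summable complex functions on the lattice. -/
abbrev EllTwo (d : ℕ) : Type := lp (fun _ : ZLattice d => ℂ) 2

/-- `φ` is an eigenfunction of the (possibly unbounded, only partially defined)
linear operator `H` on `ℓ²(ℤ^d)`. -/
def IsEigenfunction {d : ℕ} (H : EllTwo d →ₗ.[ℂ] EllTwo d) (φ : EllTwo d) : Prop :=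
  φ ≠ 0 ∧ ∃ (μ : ℂ) (hφ : φ ∈ H.domain), H ⟨φ, hφ⟩ = μ • φ

/-- The set of localization centers of `φ`: the sites where `|φ|` attains its maximum. -/
def localizationCenters {d : ℕ} (φ : EllTwo d) : Set (ZLattice d) :=
  {l | ∀ x : ZLattice d, ‖φ x‖ ≤ ‖φ l‖}

/-- Semi-uniform localization control of `φ` with constants `C`, `c`, `q`. -/
def SemiUniformlyLocalized {d : ℕ} (C c q : ℝ) (φ : EllTwo d) : Prop :=
  ∀ l ∈ localizationCenters φ, ∀ x : ZLattice d,
    ‖φ x‖ ≤ C * (1 + ‖l‖) ^ q * Real.exp (-c * ‖x - l‖)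

open scoped ENNReal

/-! ### Matchings from doubly stochastic weights -/

/-! By Parseval in both directions, the weights `‖ψ s x‖ ^ 2` form a doubly stochastic matrix.
Choose a center `l s` for each `s` and relate `x` to `s` when `‖x - l s‖ ≤ δ * (‖l s‖ + L)`.
Localization makes the total weight off this relation less than one for large `L`. Since
cardinalities are integers, a defect below one cannot violate Hall's condition on either side. The
two injections combine by Schröder–Bernstein into a bijection inside the relation, which for `‖j‖ ≥
L` forces `‖j - l (f j)‖ ≤ ε * ‖j‖`. -/

/-- If a weight matrix has row sums one and column sums at most one, and a locally finite relation
carries all of the weight up to a total defect smaller than one, then Hall's condition holds, so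
the relation contains an injection. -/
theorem exists_injective_of_tsum_defect_lt_one {α β : Type*} (a : α → β → ℝ≥0∞)
    (hrow : ∀ x, ∑' s, a x s = 1) (hcol : ∀ s, ∑' x, a x s ≤ 1) (R : α → β → Prop)
    (hfin : ∀ x, {s | R x s}.Finite)
    (hdefect : ∑' x, ∑' s, {s | ¬ R x s}.indicator (a x) s < 1) :
    ∃ f : α → β, Function.Injective f ∧ ∀ x, R x (f x) := by
  classical
  have hall : ∀ A : Finset α, A.card ≤ (A.biUnion fun x => (hfin x).toFinset).card := by
    intro A
    set B := A.biUnion fun x => (hfin x).toFinset with hB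
    have hsplit : ∀ x ∈ A, (1 : ℝ≥0∞) ≤
        ∑ s ∈ B, a x s + ∑' s, {s | ¬ R x s}.indicator (a x) s := by
      intro x hx
      rw [← hrow x, sum_eq_tsum_indicator, ← ENNReal.tsum_add]
      refine ENNReal.tsum_le_tsum fun s => ?_
      by_cases h : R x s
      · have hs : s ∈ (B : Set β) := by
          rw [hB, Finset.mem_coe, Finset.mem_biUnion]
          exact ⟨x, hx, by simpa using h⟩
        rw [Set.indicator_of_mem hs]
        exact le_self_add
      · rw [Set.indicator_of_mem (s := {s | ¬ R x s}) h]
        exact le_add_self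
    have hA : (A.card : ℝ≥0∞) ≤
        B.card + ∑' x, ∑' s, {s | ¬ R x s}.indicator (a x) s := by
      calc (A.card : ℝ≥0∞) = ∑ x ∈ A, 1 := by simp
        _ ≤ ∑ x ∈ A, (∑ s ∈ B, a x s + ∑' s, {s | ¬ R x s}.indicator (a x) s) :=
          Finset.sum_le_sum hsplit
        _ = ∑ s ∈ B, ∑ x ∈ A, a x s + ∑ x ∈ A, ∑' s, {s | ¬ R x s}.indicator (a x) s := by
          rw [Finset.sum_add_distrib, Finset.sum_comm]
        _ ≤ ∑ s ∈ B, 1 + ∑' x, ∑' s, {s | ¬ R x s}.indicator (a x) s := by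
          gcongr with s
          · exact (ENNReal.sum_le_tsum A).trans (hcol s)
          · exact ENNReal.sum_le_tsum A
        _ = _ := by simp
    have hlt : (A.card : ℝ≥0∞) < B.card + 1 :=
      hA.trans_lt (ENNReal.add_lt_add_left (ENNReal.natCast_ne_top _) hdefect)
    exact Nat.lt_succ_iff.mp (by exact_mod_cast hlt)
  obtain ⟨f, hf, hfR⟩ := (Finset.all_card_le_biUnion_card_iff_exists_injective _).mp hall
  exact ⟨f, hf, fun x => by simpa using hfR x⟩

/-- If a doubly stochastic weight matrix is carried, up to a total defect smaller than one, by a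
relation that is locally finite on both sides, then the relation contains a bijection. -/
theorem exists_equiv_of_tsum_defect_lt_one {α β : Type*} (a : α → β → ℝ≥0∞)
    (hrow : ∀ x, ∑' s, a x s = 1) (hcol : ∀ s, ∑' x, a x s = 1) (R : α → β → Prop)
    (hfin : ∀ x, {s | R x s}.Finite) (hfin' : ∀ s, {x | R x s}.Finite)
    (hdefect : ∑' s, ∑' x, {x | ¬ R x s}.indicator (fun x => a x s) x < 1) :
    ∃ f : α ≃ β, ∀ x, R x (f x) := by
  have hdefect' : ∑' x, ∑' s, {s | ¬ R x s}.indicator (a x) s < 1 := by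
    rw [ENNReal.tsum_comm]
    exact hdefect
  obtain ⟨f, hf, hfR⟩ := exists_injective_of_tsum_defect_lt_one a hrow (fun s => (hcol s).le) R
    hfin hdefect'
  obtain ⟨g, hg, hgR⟩ := exists_injective_of_tsum_defect_lt_one (fun s x => a x s) hcol
    (fun x => (hrow x).le) (fun s x => R x s) hfin' hdefect
  -- The Schröder–Bernstein bijection follows `f` or the inverse of `g` at each point, so it stays
  -- inside `R`.
  obtain ⟨h, hh, hhR⟩ := Function.Embedding.schroeder_bernstein_of_rel hf hg R hfR hgR
  exact ⟨Equiv.ofBijective h hh, hhR⟩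

/-! ### Summability on the lattice -/

theorem summable_pi_prod {ι : Type*} {g : ι → ℝ} (hg : ∀ n, 0 ≤ g n) (hs : Summable g) (d : ℕ) :
    Summable fun l : Fin d → ι => ∏ i, g (l i) := by
  induction d with
  | zero => exact Summable.of_finite
  | succ d ih =>
    rw [← (Fin.consEquiv fun _ : Fin (d + 1) => ι).summable_iff]
    have h := hs.mul_of_nonneg ih hg fun l => Finset.prod_nonneg fun i _ => hg (l i)
    refine h.congr fun p => ?_
    simp [Fin.prod_univ_succ, Fin.consEquiv]

theorem summable_exp_neg_mul_abs_int {b : ℝ} (hb : 0 < b) :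
    Summable fun n : ℤ => Real.exp (-b * |(n : ℝ)|) := by
  have h : Summable fun n : ℕ => Real.exp (-b * |(n : ℝ)|) := by
    refine (Real.summable_exp_nat_mul_of_ge (c := -b) (by linarith) (f := fun n => (n : ℝ))
      fun n => le_rfl).congr fun n => ?_
    rw [Nat.abs_cast]
  refine Summable.of_nat_of_neg (by simpa using h) (by simpa using h)

theorem summable_exp_neg_mul_norm {d : ℕ} {b : ℝ} (hb : 0 < b) :
    Summable fun l : ZLattice d => Real.exp (-b * ‖l‖) := by
  -- The sum of the coordinates' absolute values is at most `d * ‖l‖`; dividing by `d + 1` also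
  -- covers `d = 0`.
  have hb' : 0 < b / (d + 1) := by positivity
  refine Summable.of_nonneg_of_le (fun _ => (Real.exp_pos _).le) (fun l => ?_)
    (summable_pi_prod (fun n => (Real.exp_pos _).le) (summable_exp_neg_mul_abs_int hb') d)
  rw [← Real.exp_sum, Real.exp_le_exp]
  calc -b * ‖l‖ ≤ -(b / (d + 1)) * (d * ‖l‖) := by
        have h : b / (d + 1) * (d + 1) = b := by field_simp
        nlinarith [norm_nonneg l, mul_nonneg hb'.le (norm_nonneg l)]
    _ ≤ -(b / (d + 1)) * ∑ i, |(l i : ℝ)| := by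
        have h : ∑ i, |(l i : ℝ)| ≤ d * ‖l‖ := by
          calc ∑ i, |(l i : ℝ)| ≤ ∑ _i : Fin d, ‖l‖ :=
                Finset.sum_le_sum fun i _ => (Int.norm_eq_abs (l i)).symm.trans_le (norm_le_pi_norm l i)
            _ = d * ‖l‖ := by simp
        nlinarith
    _ = _ := Finset.mul_sum _ _ _

theorem one_add_rpow_le_mul_exp {p b t : ℝ} (hp : 0 < p) (hb : 0 < b) (ht : 0 ≤ t) :
    (1 + t) ^ p ≤ (1 + p / b) ^ p * Real.exp (b * t) := by
  have h1 : 1 + t ≤ (1 + p / b) * Real.exp (b * t / p) := by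
    have h2 := Real.add_one_le_exp (b * t / p)
    calc 1 + t ≤ (1 + p / b) * (b * t / p + 1) := by
          have : (1 + p / b) * (b * t / p + 1) = 1 + t + (b * t / p + p / b) := by
            field_simp
            ring
          rw [this]
          have : 0 ≤ b * t / p + p / b := by positivity
          linarith
      _ ≤ _ := by gcongr
  calc (1 + t) ^ p ≤ ((1 + p / b) * Real.exp (b * t / p)) ^ p := by gcongr
    _ = (1 + p / b) ^ p * Real.exp (b * t) := by
      rw [Real.mul_rpow (by positivity) (Real.exp_pos _).le, ← Real.exp_mul,
        div_mul_cancel₀ _ hp.ne']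

theorem summable_one_add_norm_rpow_mul_exp {d : ℕ} {p b : ℝ} (hp : 0 < p) (hb : 0 < b) :
    Summable fun l : ZLattice d => (1 + ‖l‖) ^ p * Real.exp (-b * ‖l‖) := by
  refine Summable.of_nonneg_of_le (fun _ => by positivity) (fun l => ?_)
    ((summable_exp_neg_mul_norm (half_pos hb)).mul_left ((1 + p / (b / 2)) ^ p))
  calc (1 + ‖l‖) ^ p * Real.exp (-b * ‖l‖)
      ≤ ((1 + p / (b / 2)) ^ p * Real.exp (b / 2 * ‖l‖)) * Real.exp (-b * ‖l‖) := by
        gcongr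
        exact one_add_rpow_le_mul_exp hp (half_pos hb) (norm_nonneg l)
    _ = _ := by
        rw [mul_assoc, ← Real.exp_add]
        ring_nf

theorem finite_setOf_norm_sub_le {d : ℕ} (l : ZLattice d) (r : ℝ) :
    {x : ZLattice d | ‖x - l‖ ≤ r}.Finite := by
  have h : {x : ZLattice d | ‖x - l‖ ≤ r} = Metric.closedBall l r := by
    ext x
    simp [dist_eq_norm]
  rw [h]
  exact (isCompact_closedBall l r).finite_of_discrete

/-! ### Square-summable functions and localization centers -/

theorem EllTwo.hasSum_norm_sq {d : ℕ} (φ : EllTwo d) :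
    HasSum (fun x => ‖φ x‖ ^ 2) (‖φ‖ ^ 2) := by
  simpa using lp.hasSum_norm (p := 2) (by simp) φ

/-- Parseval for the unit vector supported at `x`. -/
theorem HilbertBasis.hasSum_norm_sq_apply {d : ℕ} {ι : Type*} (ψ : HilbertBasis ι ℂ (EllTwo d))
    (x : ZLattice d) : HasSum (fun s => ‖ψ s x‖ ^ 2) 1 := by
  have h := ψ.hasSum_inner_mul_inner (lp.single 2 x (1 : ℂ)) (lp.single 2 x (1 : ℂ))
  simp only [lp.inner_single_left, lp.inner_single_right] at h
  convert! Complex.hasSum_re h using 1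
  · ext s
    simp [← Complex.normSq_eq_norm_sq, Complex.normSq_apply]
  · simp

theorem localizationCenters_nonempty {d : ℕ} (φ : EllTwo d) :
    (localizationCenters φ).Nonempty := by
  by_cases h : ∀ x, φ x = 0
  · exact ⟨0, fun x => by simp [h]⟩
  · push Not at h
    obtain ⟨x₀, hx₀⟩ := h
    -- Square-summability forces decay at infinity, so the maximum is over a finite set.
    have hfin : {x | ‖φ x₀‖ ≤ ‖φ x‖}.Finite := by
      have ht := (EllTwo.hasSum_norm_sq φ).summable.tendsto_cofinite_zero
      have hev := ht.eventually_lt_const (show 0 < ‖φ x₀‖ ^ 2 by positivity)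
      refine (Filter.eventually_cofinite.mp hev).subset fun x hx => ?_
      simpa using pow_le_pow_left₀ (norm_nonneg _) hx 2
    obtain ⟨l, hl, hmax⟩ := Set.exists_max_image _ (fun x => ‖φ x‖) hfin ⟨x₀, le_refl ‖φ x₀‖⟩
    refine ⟨l, fun x => ?_⟩
    by_cases hx : ‖φ x₀‖ ≤ ‖φ x‖
    · exact hmax x hx
    · exact (not_le.mp hx).le.trans hl

section Localized

variable {d : ℕ} {C c q : ℝ} {φ : EllTwo d} {l : ZLattice d}

theorem hasSum_exp_neg_mul_norm_sub (hc : 0 < c) (l : ZLattice d) :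
    HasSum (fun x : ZLattice d => Real.exp (-c * ‖x - l‖))
      (∑' x : ZLattice d, Real.exp (-c * ‖x‖)) :=
  (Equiv.subRight l).hasSum_iff.mpr (summable_exp_neg_mul_norm (d := d) hc).hasSum

/-- A normalized localized function is not too small at its localization centers. -/
theorem SemiUniformlyLocalized.one_le_norm_center (hc : 0 < c)
    (hφ : SemiUniformlyLocalized C c q φ) (hn : ‖φ‖ = 1) (hl : l ∈ localizationCenters φ) :
    1 ≤ C * (∑' x : ZLattice d, Real.exp (-c * ‖x‖)) * (1 + ‖l‖) ^ q * ‖φ l‖ := by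
  have h1 := EllTwo.hasSum_norm_sq φ
  -- In `‖φ x‖ ^ 2`, one factor is bounded by the maximum `‖φ l‖`, the other by the exponential
  -- decay.
  have h2 := (hasSum_exp_neg_mul_norm_sub hc l).mul_left (‖φ l‖ * (C * (1 + ‖l‖) ^ q))
  have h3 := hasSum_le (fun x => ?_) h1 h2
  · rw [hn] at h3
    linarith
  · rw [sq, mul_assoc]
    exact mul_le_mul (hl x) (hφ l hl x) (norm_nonneg _) (norm_nonneg _)

/-- The mass of a localized function far away from a localization center. -/
theorem SemiUniformlyLocalized.tsum_indicator_le (hc : 0 < c)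
    (hφ : SemiUniformlyLocalized C c q φ) (hl : l ∈ localizationCenters φ) (r : ℝ) :
    ∑' x, {x | ¬ ‖x - l‖ ≤ r}.indicator (fun x => ENNReal.ofReal (‖φ x‖ ^ 2)) x ≤
      ENNReal.ofReal ((C * (1 + ‖l‖) ^ q) ^ 2 * Real.exp (-c * r) *
        ∑' x : ZLattice d, Real.exp (-c * ‖x‖)) := by
  have h := (hasSum_exp_neg_mul_norm_sub hc l).mul_left
    ((C * (1 + ‖l‖) ^ q) ^ 2 * Real.exp (-c * r))
  rw [← h.tsum_eq, ENNReal.ofReal_tsum_of_nonneg (fun x => by positivity) h.summable]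
  refine ENNReal.tsum_le_tsum fun x => Set.indicator_apply_le' (fun hx => ?_) fun _ => zero_le
  refine ENNReal.ofReal_le_ofReal ?_
  have hx' : r ≤ ‖x - l‖ := (not_le.mp hx).le
  calc ‖φ x‖ ^ 2 ≤ (C * (1 + ‖l‖) ^ q * Real.exp (-c * ‖x - l‖)) ^ 2 := by
        gcongr
        exact hφ l hl x
    _ = (C * (1 + ‖l‖) ^ q) ^ 2 * Real.exp (-c * ‖x - l‖) * Real.exp (-c * ‖x - l‖) := by ring
    -- One exponential is spent on the gain at radius `r`; the other is kept for summability.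
    _ ≤ _ := by
        gcongr ?_ * Real.exp ?_ * _
        nlinarith

/-- The mass of a normalized localized function far away from a localization center, compared with
its mass at that center. -/
theorem SemiUniformlyLocalized.tsum_indicator_le_mul_center (hc : 0 < c)
    (hφ : SemiUniformlyLocalized C c q φ) (hn : ‖φ‖ = 1) (hl : l ∈ localizationCenters φ) (r : ℝ) :
    ∑' x, {x | ¬ ‖x - l‖ ≤ r}.indicator (fun x => ENNReal.ofReal (‖φ x‖ ^ 2)) x ≤
      ENNReal.ofReal (‖φ l‖ ^ 2) * ENNReal.ofReal
        (C ^ 4 * (∑' x : ZLattice d, Real.exp (-c * ‖x‖)) ^ 3 *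
          (1 + ‖l‖) ^ (q * 4) * Real.exp (-c * r)) := by
  refine (hφ.tsum_indicator_le hc hl r).trans ?_
  rw [← ENNReal.ofReal_mul (by positivity)]
  refine ENNReal.ofReal_le_ofReal ?_
  have h1 := hφ.one_le_norm_center hc hn hl
  have hK : 0 ≤ ∑' x : ZLattice d, Real.exp (-c * ‖x‖) := tsum_nonneg fun _ => (Real.exp_pos _).le
  have hw : (1 + ‖l‖) ^ (q * 4) = ((1 + ‖l‖) ^ q) ^ 4 := by
    exact_mod_cast Real.rpow_mul_natCast (by positivity) q 4
  rw [hw]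
  generalize (∑' x : ZLattice d, Real.exp (-c * ‖x‖)) = K at *
  generalize (1 + ‖l‖) ^ q = w at *
  -- Squaring the lower bound at the center brings in `‖φ l‖ ^ 2`, at the cost of `(C * K * w) ^ 2`.
  calc (C * w) ^ 2 * Real.exp (-c * r) * K
      ≤ (C * w) ^ 2 * Real.exp (-c * r) * K * (C * K * w * ‖φ l‖) ^ 2 :=
        le_mul_of_one_le_right (by positivity) (one_le_pow₀ h1)
    _ = _ := by ring

end Localized

/-- The scale beyond which the total mass outside the neighbourhoods is smaller than one. -/
theorem exists_scale_tsum_lt_one (d : ℕ) {C c q δ : ℝ} (hC : 0 < C) (hc : 0 < c) (hq : 0 < q)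
    (hδ : 0 < δ) :
    ∃ L : ℝ, 500 ≤ L ∧ ∑' l : ZLattice d, ENNReal.ofReal
        (C ^ 4 * (∑' x : ZLattice d, Real.exp (-c * ‖x‖)) ^ 3 *
          (1 + ‖l‖) ^ (q * 4) * Real.exp (-c * (δ * (‖l‖ + L)))) < 1 := by
  set A := C ^ 4 * (∑' x : ZLattice d, Real.exp (-c * ‖x‖)) ^ 3 with hA
  have hA0 : 0 ≤ A := by
    have : 0 ≤ ∑' x : ZLattice d, Real.exp (-c * ‖x‖) := tsum_nonneg fun _ => (Real.exp_pos _).le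
    positivity
  have hs := (summable_one_add_norm_rpow_mul_exp (d := d) (p := q * 4) (b := c * δ)
    (by positivity) (by positivity)).hasSum
  set T := ∑' l : ZLattice d, (1 + ‖l‖) ^ (q * 4) * Real.exp (-(c * δ) * ‖l‖)
  have hlim : Filter.Tendsto (fun L : ℝ => A * Real.exp (-(c * δ * L)) * T) Filter.atTop
      (nhds (A * 0 * T)) :=
    ((Real.tendsto_exp_neg_atTop_nhds_zero.comp
      (Filter.tendsto_id.const_mul_atTop (by positivity))).const_mul A).mul_const T
  obtain ⟨L, hL, hL1⟩ := ((Filter.eventually_ge_atTop (500 : ℝ)).and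
    (hlim.eventually_lt_const (show A * 0 * T < 1 by simp))).exists
  refine ⟨L, hL, ?_⟩
  have h := hs.mul_left (A * Real.exp (-(c * δ * L)))
  have heq : ∀ l : ZLattice d, A * (1 + ‖l‖) ^ (q * 4) * Real.exp (-c * (δ * (‖l‖ + L))) =
      A * Real.exp (-(c * δ * L)) * ((1 + ‖l‖) ^ (q * 4) * Real.exp (-(c * δ) * ‖l‖)) := by
    intro l
    rw [show -c * (δ * (‖l‖ + L)) = -(c * δ * L) + -(c * δ) * ‖l‖ by ring, Real.exp_add]
    ring
  simp_rw [heq]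
  rw [← ENNReal.ofReal_tsum_of_nonneg (fun l => by positivity) h.summable, h.tsum_eq]
  simpa using hL1

theorem theoremB6 (d : ℕ) (C c q ε : ℝ) (hC : 0 < C) (hc : 0 < c) (hq : 0 < q) (hε : 0 < ε) :
    ∃ L : ℝ, 500 ≤ L ∧
      ∀ (H : EllTwo d →ₗ.[ℂ] EllTwo d) (ψ : HilbertBasis (ZLattice d) ℂ (EllTwo d)),
        (∀ s, IsEigenfunction H (ψ s)) →
        (∀ s, SemiUniformlyLocalized C c q (ψ s)) →
        ∃ f : ZLattice d ≃ ZLattice d,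
          ∀ j : ZLattice d, L ≤ ‖j‖ →
            ∃ l ∈ localizationCenters (ψ (f j)), ‖j - l‖ ≤ ε * ‖j‖ := by
  -- `δ ≤ 1 / 2` absorbs `‖l s‖`, giving `‖l s‖ ≤ 2 * ‖j‖ + L`. If `L ≤ ‖j‖`, then `‖l s‖ + L ≤ 4 *
  -- ‖j‖`, whence `ε / 4`.
  obtain ⟨δ, hδ, hδ2, hδε⟩ : ∃ δ : ℝ, 0 < δ ∧ δ ≤ 1 / 2 ∧ δ ≤ ε / 4 :=
    ⟨min (1 / 2) (ε / 4), by positivity, min_le_left _ _, min_le_right _ _⟩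
  obtain ⟨L, hL, hsum⟩ := exists_scale_tsum_lt_one d hC hc hq hδ
  refine ⟨L, hL, fun H ψ _ hloc => ?_⟩
  choose l hl using fun s => localizationCenters_nonempty (ψ s)
  have hn : ∀ s, ‖ψ s‖ = 1 := ψ.orthonormal.1
  have hrow : ∀ x, ∑' s, ENNReal.ofReal (‖ψ s x‖ ^ 2) = 1 := fun x => by
    have h := ψ.hasSum_norm_sq_apply x
    rw [← ENNReal.ofReal_tsum_of_nonneg (fun _ => by positivity) h.summable, h.tsum_eq]
    simp
  have hcol : ∀ s, ∑' x, ENNReal.ofReal (‖ψ s x‖ ^ 2) = 1 := fun s => by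
    have h := EllTwo.hasSum_norm_sq (ψ s)
    rw [← ENNReal.ofReal_tsum_of_nonneg (fun _ => by positivity) h.summable, h.tsum_eq, hn]
    simp
  -- each site is the chosen center of finitely many eigenfunctions
  have hfiber : ∀ y, {s | l s = y}.Finite := fun y => by
    set D := C * (∑' x : ZLattice d, Real.exp (-c * ‖x‖)) * (1 + ‖y‖) ^ q
    have hD : ∀ s, l s = y → 1 ≤ D * ‖ψ s y‖ := by
      rintro s rfl
      exact (hloc s).one_le_norm_center hc (hn s) (hl s)
    rcases le_or_gt D 0 with hD0 | hD0
    · convert Set.finite_empty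
      refine Set.eq_empty_of_forall_notMem fun s hs => ?_
      nlinarith [hD s hs, norm_nonneg (ψ s y)]
    -- Each `s` in the fiber contributes at least `D⁻¹ ^ 2` to a row of total weight one.
    refine (ENNReal.finite_const_le_of_tsum_ne_top (ε := ENNReal.ofReal (D⁻¹ ^ 2))
      ((hrow y).trans_ne ENNReal.one_ne_top) (by simpa using by positivity)).subset fun s hs => ?_
    refine ENNReal.ofReal_le_ofReal (pow_le_pow_left₀ (by positivity) ?_ 2)
    rw [inv_le_iff_one_le_mul₀' hD0]
    exact hD s hs
  have hdist : ∀ j s, ‖j - l s‖ ≤ δ * (‖l s‖ + L) → ‖l s‖ ≤ 2 * ‖j‖ + L := fun j s h => by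
    have h1 := norm_sub_norm_le (l s) j
    rw [norm_sub_rev] at h1
    nlinarith [norm_nonneg (l s)]
  obtain ⟨f, hf⟩ := exists_equiv_of_tsum_defect_lt_one
    (fun x s => ENNReal.ofReal (‖ψ s x‖ ^ 2)) hrow hcol
    (fun x s => ‖x - l s‖ ≤ δ * (‖l s‖ + L))
    (fun x => by
      refine ((finite_setOf_norm_sub_le (0 : ZLattice d) (2 * ‖x‖ + L)).biUnion
        fun y _ => hfiber y).subset fun s hs => ?_
      simpa using hdist x s hs)
    (fun s => finite_setOf_norm_sub_le _ _) (by
      refine lt_of_le_of_lt ?_ hsum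
      -- Many `s` may share a center. Keeping the weight `‖ψ s (l s)‖ ^ 2` and enlarging to all `y`
      -- handles this: after swapping the sums, each `y` carries total weight one.
      calc _ ≤ ∑' s, ∑' y, ENNReal.ofReal (‖ψ s y‖ ^ 2) * ENNReal.ofReal
              (C ^ 4 * (∑' x : ZLattice d, Real.exp (-c * ‖x‖)) ^ 3 *
                (1 + ‖y‖) ^ (q * 4) * Real.exp (-c * (δ * (‖y‖ + L)))) :=
            ENNReal.tsum_le_tsum fun s =>
              ((hloc s).tsum_indicator_le_mul_center hc (hn s) (hl s) _).trans
                (ENNReal.le_tsum (l s))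
        _ = _ := by
            rw [ENNReal.tsum_comm]
            simp_rw [ENNReal.tsum_mul_right, hrow, one_mul])
  refine ⟨f, fun j hj => ⟨l (f j), hl _, ?_⟩⟩
  have h1 := hf j
  have h2 := hdist j (f j) h1
  nlinarith [norm_nonneg j]
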